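/- Let $\mathsf H$ be a complex Hilbert space (inner product antilinear in the left entry) and let $Q$ be a normalized positive-operator valued measure (POVM) on the Borel sets of $\mathbb R$ in $\mathsf H$: a map $E\mapsto Q(E)$ into the bounded operators on $\mathsf H$ with $Q(E)\ge 0$ for all $E$, such that $Q_{\varphi,\psi}(E):=\langle\varphi|Q(E)\psi\rangle$ is a complex ($\sigma$-additive) measure for all $\varphi,\psi\in\mathsf H$, and $Q(\mathbb R)=I$. Put $$D:=\Big\{\psi\in\mathsf H\ \Big|\ \int_{\mathbb R}\lambda^2\,dQ_{\psi,\psi}(\lambda)<+\infty\Big\}.$$ A projection-valued measure (PVM) is a normalized POVM $P$ with $P(E)P(F)=P(E\cap F)$ for all $E,F$. For a PVM $P$ on $\mathbb R$ in a Hilbert space $\mathsf K$, $\int_{\mathbb R}\lambda\,dP(\lambda)$ denotes the operator with domain $\{x\in\mathsf K\mid\int\lambda^2\,dP_{x,x}<\infty\}$ that maps $x$ to the limit of the vectors $\sum_c c\,P(s^{-1}\{c\})x$ for simple functions $s$ tending to $\lambda\mapsto\lambda$ in $L^2(\mathbb R,P_{x,x})$. A Naimark dilation triple $(\mathsf K,P_{\mathsf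 H},P)$ of $Q$ consists of a Hilbert space $\mathsf K$ that contains $\mathsf H$ as a closed subspace (through an isometric embedding), the orthogonal projector $P_{\mathsf H}$ of $\mathsf K$ onto $\mathsf H$, and a PVM $P$ on $\mathbb R$ in $\mathsf K$ with $Q(E)=P_{\mathsf H}P(E)|_{\mathsf H}$ for all Borel sets $E$. Operators are linear and defined on a linear subspace; an operator $A$ is Hermitian if $\langle Ax|y\rangle=\langle x|Ay\rangle$ for all $x,y$ in its domain, and symmetric if moreover its domain is dense. Then: (a) $D$ is a linear subspace of $\mathsf H$. It is not necessarily dense or non-trivial: if $\mathsf H\ne\{0\}$, there are normalized POVMs on $\mathbb R$ in $\mathsf H$ for which the corresponding subspace is not dense, and ones for which it is $\{0\}$. (b) For all $\varphi\in\mathsf H$ and $\psi\in D$ the function $\lambda\mapsto\lambda$ is integrable with respect to $Q_{\varphi,\psi}$, and there is a unique operator $A^{(Q)}:D\to\mathsf H$ such that $$\langle\varphi|A^{(Q)}\psi\rangle=\int_{\mathbb R}\lambda\,dQ_{\varphi,\psi}(\lambda)\qquad\text{for all }\varphi\in\mathsf H,\ \psi\in D.$$ (c) $A^{(Q)}$ is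 Hermitian; hence $A^{(Q)}$ is symmetric if and only if $D$ is dense. (d) If $(\mathsf K,P_{\mathsf H},P)$ is a Naimark dilation triple of $Q$, then every $\psi\in D$ lies in the domain of $\int_{\mathbb R}\lambda\,dP(\lambda)$ and $$A^{(Q)}\psi=P_{\mathsf H}\int_{\mathbb R}\lambda\,dP(\lambda)\,\psi .$$ (e) If there is a Naimark dilation triple $(\mathsf K,P_{\mathsf H},P)$ of $Q$ such that $\int_{\mathbb R}\lambda\,dP(\lambda)$ maps $D$ into $\mathsf H$, then $A^{(Q)}$ is closed and $$\|A^{(Q)}\psi\|^2=\int_{\mathbb R}\lambda^2\,dQ_{\psi,\psi}(\lambda)\qquad\text{for all }\psi\in D.$$ -/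

import Mathlib

open MeasureTheory Filter Topology
open scoped ENNReal

noncomputable section

/-- A positive-operator valued measure on the measurable space `Ω` in the Hilbert space `H`.
As for Mathlib's vector measures, `Q` takes the value `0` on non-measurable sets, so that it carries
no information besides its values on the σ-algebra. The inner product is antilinear on the left. -/
structure POVM (Ω : Type*) [MeasurableSpace Ω] (H : Type*) [NormedAddCommGroup H]
    [InnerProductSpace ℂ H] where
  /-- the operator `Q(E)` -/
  op : Set Ω → H →L[ℂ] H
  op_of_not_measurable : ∀ E, ¬ MeasurableSet E → op E = 0
  isPositive : ∀ E, MeasurableSet E → (op E).IsPositive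
  hasSum_inner : ∀ (φ ψ : H) (E : ℕ → Set Ω), (∀ n, MeasurableSet (E n)) →
    Pairwise (fun m n => Disjoint (E m) (E n)) →
    HasSum (fun n => inner ℂ φ (op (E n) ψ)) (inner ℂ φ (op (⋃ n, E n) ψ))

namespace POVM

variable {Ω : Type*} [MeasurableSpace Ω] {H : Type*} [NormedAddCommGroup H]
  [InnerProductSpace ℂ H]

/-- `Q` is normalized if `Q(Ω) = I`. -/
def IsNormalized (Q : POVM Ω H) : Prop := Q.op Set.univ = 1

theorem op_empty (Q : POVM Ω H) : Q.op ∅ = 0 := by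
  ext ψ
  refine ext_inner_left ℂ fun φ => ?_
  have h := Q.hasSum_inner φ ψ (fun _ => ∅) (fun _ => MeasurableSet.empty)
    (fun _ _ _ => by simp)
  have h0 : inner ℂ φ (Q.op ∅ ψ) = 0 := (summable_const_iff _).1 h.summable
  simpa using h0

/-- The complex measure `Q_{φ,ψ}(E) = ⟨φ | Q(E) ψ⟩`. -/
def complexMeasure (Q : POVM Ω H) (φ ψ : H) : ComplexMeasure Ω where
  measureOf' E := inner ℂ φ (Q.op E ψ)
  empty' := by simp [Q.op_empty]
  not_measurable' E hE := by simp [Q.op_of_not_measurable E hE]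
  m_iUnion' E hE hd := Q.hasSum_inner φ ψ E hE hd

/-- The finite positive measure `Q_{ψ,ψ}(E) = ⟨ψ | Q(E) ψ⟩`. -/
def diagMeasure (Q : POVM Ω H) (ψ : H) : Measure Ω :=
  Measure.ofMeasurable (fun E _ => ENNReal.ofReal (inner ℂ ψ (Q.op E ψ)).re)
    (by simp [Q.op_empty])
    (fun E hE hd => by
      have h := (Complex.hasSum_iff _ _).1 (Q.hasSum_inner ψ ψ E hE hd) |>.1
      rw [← h.tsum_eq]
      exact ENNReal.ofReal_tsum_of_nonneg
        (fun n => (Q.isPositive _ (hE n)).re_inner_nonneg_right ψ) h.summable)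

theorem diagMeasure_apply (Q : POVM Ω H) (ψ : H) {E : Set Ω} (hE : MeasurableSet E) :
    Q.diagMeasure ψ E = ENNReal.ofReal (inner ℂ ψ (Q.op E ψ)).re :=
  Measure.ofMeasurable_apply E hE

/-- The set `{ψ | ∫ λ² dQ_{ψ,ψ}(λ) < ∞}` of a POVM on the real line. -/
def sqDomain (Q : POVM ℝ H) : Set H :=
  {ψ | ∫⁻ t, ENNReal.ofReal (t ^ 2) ∂(Q.diagMeasure ψ) < ∞}

/-- `A` is an operator with domain `{ψ | ∫ λ² dQ_{ψ,ψ}(λ) < ∞}` such that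
`⟨φ | A ψ⟩ = ∫ λ dQ_{φ,ψ}(λ)` for all `φ` in `H` and all `ψ` in the domain. -/
def IsWeakIntegral (Q : POVM ℝ H) (A : H →ₗ.[ℂ] H) : Prop :=
  (A.domain : Set H) = Q.sqDomain ∧
    ∀ (φ : H) (ψ : A.domain),
      inner ℂ φ (A ψ) =
        VectorMeasure.integral (Q.complexMeasure φ (ψ : H)) (fun t : ℝ => t)
          (ContinuousLinearMap.lsmul ℝ ℝ)

theorem diagMeasure_add_le (Q : POVM Ω H) (x y : H) :
    Q.diagMeasure (x + y) ≤ (2 : ℝ≥0∞) • (Q.diagMeasure x + Q.diagMeasure y) := by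
  refine Measure.le_iff.2 fun E hE => ?_
  have h1 := (Q.isPositive E hE).re_inner_nonneg_right (x - y)
  have hx := (Q.isPositive E hE).re_inner_nonneg_right x
  have hy := (Q.isPositive E hE).re_inner_nonneg_right y
  simp only [RCLike.re_to_complex] at h1 hx hy
  simp only [Measure.smul_apply, Measure.add_apply, smul_eq_mul, Q.diagMeasure_apply _ hE]
  rw [← ENNReal.ofReal_add hx hy, show (2 : ℝ≥0∞) = ENNReal.ofReal 2 by simp,
    ← ENNReal.ofReal_mul (by norm_num)]
  apply ENNReal.ofReal_le_ofReal
  simp only [map_add, map_sub, inner_add_left, inner_add_right, inner_sub_left, inner_sub_right,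
    Complex.add_re, Complex.sub_re] at h1 ⊢
  linarith

theorem diagMeasure_smul (Q : POVM Ω H) (c : ℂ) (x : H) :
    Q.diagMeasure (c • x) = ENNReal.ofReal (‖c‖ ^ 2) • Q.diagMeasure x := by
  ext E hE
  rw [Measure.smul_apply, Q.diagMeasure_apply _ hE, Q.diagMeasure_apply _ hE, smul_eq_mul,
    ← ENNReal.ofReal_mul (by positivity)]
  congr 1
  rw [map_smul, inner_smul_left, inner_smul_right, ← mul_assoc, ← Complex.normSq_eq_conj_mul_self,
    Complex.re_ofReal_mul, Complex.normSq_eq_norm_sq]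

theorem diagMeasure_zero (Q : POVM Ω H) : Q.diagMeasure 0 = 0 := by
  ext E hE
  simp [Q.diagMeasure_apply _ hE]

instance (Q : POVM Ω H) (x : H) : IsFiniteMeasure (Q.diagMeasure x) :=
  ⟨by rw [Q.diagMeasure_apply _ MeasurableSet.univ]; exact ENNReal.ofReal_lt_top⟩

/-- The set `{ψ | ∫ λ² dQ_{ψ,ψ}(λ) < ∞}` as a subspace. -/
def sqSubmodule (Q : POVM ℝ H) : Submodule ℂ H where
  carrier := Q.sqDomain
  zero_mem' := by simp [sqDomain, Q.diagMeasure_zero]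
  add_mem' := by
    intro x y hx hy
    refine (lintegral_mono' (Q.diagMeasure_add_le x y) le_rfl).trans_lt ?_
    rw [lintegral_smul_measure, lintegral_add_measure]
    exact ENNReal.mul_lt_top (by simp) (ENNReal.add_lt_top.2 ⟨hx, hy⟩)
  smul_mem' := by
    intro c x hx
    change ∫⁻ t, ENNReal.ofReal (t ^ 2) ∂(Q.diagMeasure (c • x)) < ∞
    rw [Q.diagMeasure_smul, lintegral_smul_measure]
    exact ENNReal.mul_lt_top ENNReal.ofReal_lt_top hx

end POVM

/-- A projection-valued measure: a normalized POVM with `P(E) P(F) = P(E ∩ F)`. -/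
structure PVM (Ω : Type*) [MeasurableSpace Ω] (K : Type*) [NormedAddCommGroup K]
    [InnerProductSpace ℂ K] extends POVM Ω K where
  isNormalized : toPOVM.IsNormalized
  op_mul_op : ∀ E F, MeasurableSet E → MeasurableSet F → op E * op F = op (E ∩ F)

namespace PVM

variable {Ω : Type*} [MeasurableSpace Ω] {K : Type*} [NormedAddCommGroup K]
  [InnerProductSpace ℂ K]

/-- The integral `∫ s dP = ∑ c • P(s = c)` of a real simple function. -/
def simpleIntegral (P : PVM Ω K) (s : SimpleFunc Ω ℝ) : K →L[ℂ] K :=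
  ∑ c ∈ s.range, (c : ℂ) • P.op (s ⁻¹' {c})

theorem inner_op_op (P : PVM Ω K) {E F : Set Ω} (hE : MeasurableSet E) (hF : MeasurableSet F)
    (x y : K) : inner ℂ (P.op E x) (P.op F y) = inner ℂ x (P.op (E ∩ F) y) := by
  rw [← P.op_mul_op E F hE hF]
  exact (P.isPositive E hE).inner_left_eq_inner_right x (P.op F y)

theorem enorm_simpleIntegral (P : PVM Ω K) (s : SimpleFunc Ω ℝ) (x : K) :
    ‖P.simpleIntegral s x‖ₑ = eLpNorm s 2 (P.diagMeasure x) := by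
  have hm : ∀ c, MeasurableSet (s ⁻¹' {c}) := s.measurableSet_fiber
  have hpos : ∀ c, 0 ≤ (inner ℂ x (P.op (s ⁻¹' {c}) x)).re := fun c =>
    (P.isPositive _ (hm c)).re_inner_nonneg_right x
  have h1 : ‖P.simpleIntegral s x‖ ^ 2 =
      ∑ c ∈ s.range, c ^ 2 * (inner ℂ x (P.op (s ⁻¹' {c}) x)).re := by
    rw [← inner_self_eq_norm_sq (𝕜 := ℂ), RCLike.re_to_complex]
    simp only [simpleIntegral, sum_apply, smul_apply]
    rw [sum_inner, Complex.re_sum]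
    refine Finset.sum_congr rfl fun c hc => ?_
    rw [inner_sum, Finset.sum_eq_single_of_mem c hc]
    · rw [inner_smul_left, inner_smul_right, P.inner_op_op (hm c) (hm c), Set.inter_self,
        Complex.conj_ofReal, Complex.re_ofReal_mul, Complex.re_ofReal_mul]
      ring
    · intro d _ hdc
      have hdis : s ⁻¹' {c} ∩ s ⁻¹' {d} = ∅ := by
        ext t
        simp only [Set.mem_inter_iff, Set.mem_preimage, Set.mem_singleton_iff,
          Set.mem_empty_iff_false, iff_false, not_and]
        intro h h'
        exact hdc (h'.symm.trans h)
      rw [inner_smul_left, inner_smul_right, P.inner_op_op (hm c) (hm d), hdis,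
        P.toPOVM.op_empty]
      simp
  have h2 : ∫⁻ t, ‖s t‖ₑ ^ 2 ∂(P.diagMeasure x) = ‖P.simpleIntegral s x‖ₑ ^ 2 := by
    have h3 : ∫⁻ t, ‖s t‖ₑ ^ 2 ∂(P.diagMeasure x) =
        (s.map fun r : ℝ => ‖r‖ₑ ^ 2).lintegral (P.diagMeasure x) := by
      rw [← SimpleFunc.lintegral_eq_lintegral]; rfl
    rw [h3, SimpleFunc.map_lintegral, ← ofReal_norm, ← ENNReal.ofReal_pow (norm_nonneg _), h1,
      ENNReal.ofReal_sum_of_nonneg (fun c _ => mul_nonneg (sq_nonneg c) (hpos c))]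
    refine Finset.sum_congr rfl fun c _ => ?_
    rw [P.toPOVM.diagMeasure_apply x (hm c), ENNReal.ofReal_mul (sq_nonneg c),
      Real.enorm_eq_ofReal_abs, ← ENNReal.ofReal_pow (abs_nonneg c), sq_abs]
  rw [eLpNorm_eq_lintegral_rpow_enorm_toReal (by simp) (by simp)]
  simp only [ENNReal.toReal_ofNat, ENNReal.rpow_ofNat, h2]
  rw [← ENNReal.rpow_ofNat, ← ENNReal.rpow_mul]
  simp

theorem simpleIntegral_sub (P : PVM Ω K) (s t : SimpleFunc Ω ℝ) (x : K) :
    P.simpleIntegral (s - t) x = P.simpleIntegral s x - P.simpleIntegral t x := by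
  let T : Set Ω → ℝ →L[ℝ] K := fun E => (ContinuousLinearMap.id ℝ ℝ).smulRight (P.op E x)
  have hT : ∀ u : SimpleFunc Ω ℝ, P.simpleIntegral u x = u.setToSimpleFunc T := by
    intro u
    simp [simpleIntegral, SimpleFunc.setToSimpleFunc, T]
  have hadd : FinMeasAdditive (0 : Measure Ω) T := by
    intro E F hE hF _ _ hd
    have : P.op (E ∪ F) x = P.op E x + P.op F x := by
      refine ext_inner_left ℂ fun φ => ?_
      rw [inner_add_right]
      exact (P.complexMeasure φ x).of_union hd hE hF
    ext
    simp [T, this]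
  rw [hT, hT, hT]
  exact SimpleFunc.setToSimpleFunc_sub T hadd integrable_zero_measure integrable_zero_measure

/-- The filter of simple functions `s` tending to the function `λ ↦ λ` in `L²(ℝ, P_{x,x})`. -/
def approxFilter (P : PVM ℝ K) (x : K) : Filter (SimpleFunc ℝ ℝ) :=
  comap (fun s : SimpleFunc ℝ ℝ => eLpNorm (fun t => s t - t) 2 (P.diagMeasure x)) (𝓝 0)

/-- A sequence of simple functions converging to `λ ↦ λ`. -/
def approxSeq (n : ℕ) : SimpleFunc ℝ ℝ :=
  SimpleFunc.approxOn (fun t : ℝ => t) measurable_id Set.univ 0 (Set.mem_univ 0) n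

theorem tendsto_approxSeq (P : PVM ℝ K) {x : K} (hx : x ∈ P.toPOVM.sqDomain) :
    Tendsto approxSeq atTop (P.approxFilter x) := by
  refine tendsto_comap_iff.2 ?_
  refine SimpleFunc.tendsto_approxOn_Lp_eLpNorm measurable_id (Set.mem_univ 0) (by simp)
    (by simp) ?_
  rw [eLpNorm_lt_top_iff_lintegral_rpow_enorm_lt_top (by simp) (by simp)]
  refine lt_of_eq_of_lt (lintegral_congr fun t => ?_) hx
  simp only [id_eq, sub_zero, ENNReal.toReal_ofNat, ENNReal.rpow_ofNat]
  rw [Real.enorm_eq_ofReal_abs, ← ENNReal.ofReal_pow (abs_nonneg t), sq_abs]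

theorem exists_tendsto_simpleIntegral [CompleteSpace K] (P : PVM ℝ K) {x : K}
    (hx : x ∈ P.toPOVM.sqDomain) :
    ∃ y, Tendsto (fun s => P.simpleIntegral s x) (P.approxFilter x) (𝓝 y) := by
  have hne : (P.approxFilter x).NeBot := (P.tendsto_approxSeq hx).neBot
  refine cauchy_map_iff_exists_tendsto.1 (EMetric.cauchy_iff.2 ⟨(hne.map _).ne, fun ε hε => ?_⟩)
  have hU : {s : SimpleFunc ℝ ℝ | eLpNorm (fun t => s t - t) 2 (P.diagMeasure x) < ε / 2} ∈
      P.approxFilter x :=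
    preimage_mem_comap (Iio_mem_nhds (ENNReal.half_pos hε.ne'))
  refine ⟨_, image_mem_map hU, ?_⟩
  rintro _ ⟨s, hs, rfl⟩ _ ⟨s', hs', rfl⟩
  dsimp only
  rw [edist_eq_enorm_sub, ← P.simpleIntegral_sub, P.enorm_simpleIntegral]
  have h : ⇑(s - s') = (fun t => s t - t) - (fun t => s' t - t) := by
    ext t
    simp
  rw [h]
  have hmeas : ∀ u : SimpleFunc ℝ ℝ,
      AEStronglyMeasurable (fun t => u t - t) (P.diagMeasure x) := fun u =>
    (u.measurable.sub measurable_id).aestronglyMeasurable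
  calc _ ≤ _ := eLpNorm_sub_le (hmeas s) (hmeas s') (by norm_num)
    _ < ε / 2 + ε / 2 := ENNReal.add_lt_add hs hs'
    _ = ε := ENNReal.add_halves ε

/-- The vector `(∫ λ dP(λ)) x`: the limit of `(∫ s dP) x` for simple functions `s` tending to
`λ ↦ λ` in `L²(ℝ, P_{x,x})`. It is used only for `x` with `∫ λ² dP_{x,x} < ∞`, where the limit
exists. -/
def integralVec (P : PVM ℝ K) (x : K) : K :=
  limUnder (P.approxFilter x) (fun s => P.simpleIntegral s x)

theorem tendsto_integralVec [CompleteSpace K] (P : PVM ℝ K) {x : K}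
    (hx : x ∈ P.toPOVM.sqDomain) :
    Tendsto (fun s => P.simpleIntegral s x) (P.approxFilter x) (𝓝 (P.integralVec x)) :=
  tendsto_nhds_limUnder (P.exists_tendsto_simpleIntegral hx)

theorem tendsto_integralVec_seq [CompleteSpace K] (P : PVM ℝ K) {x : K}
    (hx : x ∈ P.toPOVM.sqDomain) :
    Tendsto (fun n => P.simpleIntegral (approxSeq n) x) atTop (𝓝 (P.integralVec x)) :=
  (P.tendsto_integralVec hx).comp (P.tendsto_approxSeq hx)

/-- The operator `∫ λ dP(λ)` with domain `{x | ∫ λ² dP_{x,x}(λ) < ∞}`. -/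
def integral [CompleteSpace K] (P : PVM ℝ K) : K →ₗ.[ℂ] K where
  domain := P.toPOVM.sqSubmodule
  toFun :=
    { toFun := fun x => P.integralVec x
      map_add' := fun x y => by
        refine tendsto_nhds_unique (P.tendsto_integralVec_seq (x + y).2) ?_
        simpa using (P.tendsto_integralVec_seq x.2).add (P.tendsto_integralVec_seq y.2)
      map_smul' := fun c x => by
        refine tendsto_nhds_unique (P.tendsto_integralVec_seq (c • x).2) ?_
        simpa using (P.tendsto_integralVec_seq x.2).const_smul c }

end PVM

/-- A Naimark dilation triple of `Q` on the Hilbert space `K`. The inclusion of `H` in `K` as a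
closed subspace is the isometry `V`, so that `Q(E) = P_H P(E)` on `H` reads `Q(E) = V† P(E) V`. -/
structure NaimarkDilation {Ω : Type*} [MeasurableSpace Ω] {H : Type*} [NormedAddCommGroup H]
    [InnerProductSpace ℂ H] [CompleteSpace H] (Q : POVM Ω H) (K : Type*) [NormedAddCommGroup K]
    [InnerProductSpace ℂ K] [CompleteSpace K] where
  /-- the inclusion of `H` in `K` -/
  V : H →ₗᵢ[ℂ] K
  /-- the projection-valued measure in `K` -/
  P : PVM Ω K
  op_eq : ∀ E, MeasurableSet E →
    Q.op E = ContinuousLinearMap.adjoint V.toContinuousLinearMap ∘L P.op E ∘L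
      V.toContinuousLinearMap

/-- The orthogonal projector `P_H = V V†` of `K` onto (the copy of) `H`. -/
def NaimarkDilation.projH {Ω : Type*} [MeasurableSpace Ω] {H : Type*} [NormedAddCommGroup H]
    [InnerProductSpace ℂ H] [CompleteSpace H] {Q : POVM Ω H} {K : Type*} [NormedAddCommGroup K]
    [InnerProductSpace ℂ K] [CompleteSpace K] (N : NaimarkDilation Q K) : K →L[ℂ] K :=
  N.V.toContinuousLinearMap ∘L ContinuousLinearMap.adjoint N.V.toContinuousLinearMap

/-- A (not necessarily densely defined) operator is Hermitian if `⟨A x | y⟩ = ⟨x | A y⟩` on its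
domain. -/
def LinearPMap.IsHermitianOp {H : Type*} [NormedAddCommGroup H] [InnerProductSpace ℂ H]
    (A : H →ₗ.[ℂ] H) : Prop :=
  ∀ x y : A.domain, inner ℂ (A x) (y : H) = inner ℂ (x : H) (A y)

/-- An operator is symmetric if it is Hermitian and densely defined. -/
def LinearPMap.IsSymmetricOp {H : Type*} [NormedAddCommGroup H] [InnerProductSpace ℂ H]
    (A : H →ₗ.[ℂ] H) : Prop :=
  A.IsHermitianOp ∧ Dense (A.domain : Set H)

end

/-! Everything rests on one Cauchy–Schwarz inequality, `POVM.lintegral_enorm_variation_le`: ∫ |f|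
d|Q_{φ,ψ}| is at most ‖φ‖ times the L²(Q_{ψ,ψ}) norm of f. Positivity of Q(E) gives |Q_{φ,ψ}(E)|² ≤
Q_{φ,φ}(E) Q_{ψ,ψ}(E); discrete Cauchy–Schwarz carries this over to the variation (sum over a
partition) and to integrals (sum over level sets), and normalization gives Q_{φ,φ}(ℝ) = ‖φ‖².

With f = λ this is integrability on D. By duality it bounds differences of simple integrals in norm
(`POVM.edist_simpleIntegral_le`), so the integrals of simple functions tending to λ converge
strongly on D. Dominated convergence identifies the limit with the weak integral. Linearity,
hermiticity and the compression formula hold for simple functions and pass to the limit.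

If ∫ λ dP maps D into H, compressing loses nothing, and the L² isometry of a PVM gives the norm
formula. Closedness follows from that formula and the lower semicontinuity of ψ ↦ ∫ λ² dQ_{ψ,ψ}, a
form of Fatou's lemma. -/

namespace ContinuousLinearMap.IsPositive

variable {H : Type*} [NormedAddCommGroup H] [InnerProductSpace ℂ H]

/-- The positive semidefinite sesquilinear form `⟨x | T y⟩` of a positive operator. -/
@[reducible]
noncomputable def preInnerCore {T : H →L[ℂ] H} (hT : T.IsPositive) : PreInnerProductSpace.Core ℂ H where
  inner x y := inner ℂ x (T y)
  conj_inner_symm x y := by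
    rw [inner_conj_symm, hT.inner_left_eq_inner_right]
  re_inner_nonneg x := hT.re_inner_nonneg_right x
  add_left x y z := inner_add_left _ _ _
  smul_left x y r := inner_smul_left _ _ _

/-- The Cauchy–Schwarz inequality for the form `⟨x | T y⟩` of a positive operator. -/
theorem norm_inner_sq_le {T : H →L[ℂ] H} (hT : T.IsPositive) (x y : H) :
    ‖inner ℂ x (T y)‖ ^ 2 ≤ (inner ℂ x (T x)).re * (inner ℂ y (T y)).re := by
  have h : ‖inner ℂ x (T y)‖ * ‖inner ℂ y (T x)‖ ≤
      (inner ℂ x (T x)).re * (inner ℂ y (T y)).re :=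
    @InnerProductSpace.Core.inner_mul_inner_self_le ℂ H _ _ _ hT.preInnerCore x y
  have hs : ‖inner ℂ y (T x)‖ = ‖inner ℂ x (T y)‖ := by
    rw [← hT.inner_left_eq_inner_right, norm_inner_symm]
  rwa [hs, ← sq] at h

end ContinuousLinearMap.IsPositive

/-! ### Cauchy–Schwarz for the variation of a vector measure -/

namespace MeasureTheory.VectorMeasure

variable {Ω V : Type*} [MeasurableSpace Ω] [NormedAddCommGroup V]

/-- If `‖ν(E)‖² ≤ μ₁(E) μ₂(E)` for all `E`, the same bound holds for the variation of `ν`. -/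
theorem variation_apply_le_rpow_mul_rpow {ν : VectorMeasure Ω V} {μ₁ μ₂ : Measure Ω}
    (h : ∀ E, MeasurableSet E → ‖ν E‖ₑ ≤ μ₁ E ^ (1 / 2 : ℝ) * μ₂ E ^ (1 / 2 : ℝ))
    {E : Set Ω} (hE : MeasurableSet E) :
    ν.variation E ≤ μ₁ E ^ (1 / 2 : ℝ) * μ₂ E ^ (1 / 2 : ℝ) := by
  refine le_of_forall_lt fun a ha => ?_
  -- The variation is a supremum over finite disjoint families, so one such family S has to be
  -- bounded.
  obtain ⟨S, hSE, hSd, hSm, hS⟩ := ν.exists_lt_sum_of_lt_variation hE ha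
  refine hS.trans_le ?_
  have hle : ∀ μ : Measure Ω, ∑ p ∈ S, μ p ≤ μ E := fun μ => by
    have hU : μ (⋃ p ∈ S, p) = ∑ p ∈ S, μ p := measure_biUnion_finset hSd hSm
    exact hU.symm.trans_le (measure_mono (Set.iUnion₂_subset hSE))
  calc ∑ p ∈ S, ‖ν p‖ₑ
      ≤ ∑ p ∈ S, μ₁ p ^ (1 / 2 : ℝ) * μ₂ p ^ (1 / 2 : ℝ) :=
        Finset.sum_le_sum fun p hp => h p (hSm p hp)
    _ ≤ (∑ p ∈ S, (μ₁ p ^ (1 / 2 : ℝ)) ^ (2 : ℝ)) ^ (1 / 2 : ℝ) *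
          (∑ p ∈ S, (μ₂ p ^ (1 / 2 : ℝ)) ^ (2 : ℝ)) ^ (1 / 2 : ℝ) :=
        ENNReal.inner_le_Lp_mul_Lq S _ _ Real.HolderConjugate.two_two
    _ = (∑ p ∈ S, μ₁ p) ^ (1 / 2 : ℝ) * (∑ p ∈ S, μ₂ p) ^ (1 / 2 : ℝ) := by
        simp only [← ENNReal.rpow_mul]
        norm_num
    _ ≤ _ := by
        gcongr
        · exact hle μ₁
        · exact hle μ₂

/-- The Cauchy–Schwarz inequality for integrals with respect to the variation of a vector measure
`ν` with `‖ν(E)‖² ≤ μ₁(E) μ₂(E)` for all `E`. -/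
theorem lintegral_variation_le {ν : VectorMeasure Ω V} {μ₁ μ₂ : Measure Ω}
    (h : ∀ E, MeasurableSet E → ‖ν E‖ₑ ≤ μ₁ E ^ (1 / 2 : ℝ) * μ₂ E ^ (1 / 2 : ℝ))
    (f : Ω → ℝ≥0∞) :
    ∫⁻ t, f t ∂ν.variation ≤
      μ₁ Set.univ ^ (1 / 2 : ℝ) * (∫⁻ t, f t ^ (2 : ℝ) ∂μ₂) ^ (1 / 2 : ℝ) := by
  -- Unfolding to the supremum over simple functions g ≤ f avoids measurability of f. On the level
  -- sets of g, the value c goes with μ₂ in the discrete Cauchy–Schwarz inequality.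
  rw [lintegral]
  refine iSup₂_le fun g hg => ?_
  have hm := g.measurableSet_fiber
  have h1 : ∑ c ∈ g.range, μ₁ (g ⁻¹' {c}) = μ₁ Set.univ := by
    rw [g.sum_range_measure_preimage_singleton]
  have h2 : ∑ c ∈ g.range, c ^ (2 : ℝ) * μ₂ (g ⁻¹' {c}) = ∫⁻ t, g t ^ (2 : ℝ) ∂μ₂ := by
    rw [← SimpleFunc.map_lintegral, ← SimpleFunc.lintegral_eq_lintegral]
    rfl
  calc g.lintegral ν.variation = ∑ c ∈ g.range, c * ν.variation (g ⁻¹' {c}) := rfl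
    _ ≤ ∑ c ∈ g.range, μ₁ (g ⁻¹' {c}) ^ (1 / 2 : ℝ) * (c * μ₂ (g ⁻¹' {c}) ^ (1 / 2 : ℝ)) := by
        refine Finset.sum_le_sum fun c _ => ?_
        rw [mul_left_comm]
        gcongr
        exact variation_apply_le_rpow_mul_rpow h (hm c)
    _ ≤ (∑ c ∈ g.range, (μ₁ (g ⁻¹' {c}) ^ (1 / 2 : ℝ)) ^ (2 : ℝ)) ^ (1 / 2 : ℝ) *
          (∑ c ∈ g.range, (c * μ₂ (g ⁻¹' {c}) ^ (1 / 2 : ℝ)) ^ (2 : ℝ)) ^ (1 / 2 : ℝ) :=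
        ENNReal.inner_le_Lp_mul_Lq _ _ _ Real.HolderConjugate.two_two
    _ = (∑ c ∈ g.range, μ₁ (g ⁻¹' {c})) ^ (1 / 2 : ℝ) *
          (∑ c ∈ g.range, c ^ (2 : ℝ) * μ₂ (g ⁻¹' {c})) ^ (1 / 2 : ℝ) := by
        simp only [ENNReal.mul_rpow_of_nonneg _ _ zero_le_two, ← ENNReal.rpow_mul]
        norm_num
    _ ≤ _ := by
        rw [h1, h2]
        gcongr
        exact hg _

/-- The integral of a simple function with respect to a complex measure. -/
theorem integral_simpleFunc (ν : ComplexMeasure Ω) [IsFiniteMeasure ν.variation]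
    (s : SimpleFunc Ω ℝ) :
    VectorMeasure.integral ν s (ContinuousLinearMap.lsmul ℝ ℝ) =
      ∑ c ∈ s.range, (c : ℂ) * ν (s ⁻¹' {c}) := by
  have hs : Integrable s ν.variation := s.integrable_of_isFiniteMeasure
  rw [integral_eq_setToFun, setToFun_simpleFunc _ s hs]
  refine Finset.sum_congr rfl fun c _ => ?_
  rw [transpose_eq_cbmApplyMeasure, cbmApplyMeasure_apply]
  simp

end MeasureTheory.VectorMeasure

/-! ### Second moments and the approximating simple functions -/

theorem lintegral_ofReal_sq_eq_eLpNorm_sq {Ω : Type*} [MeasurableSpace Ω] (μ : Measure Ω)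
    (f : Ω → ℝ) : ∫⁻ t, ENNReal.ofReal (f t ^ 2) ∂μ = eLpNorm f 2 μ ^ 2 := by
  rw [eLpNorm_eq_lintegral_rpow_enorm_toReal (by simp) (by simp), ← ENNReal.rpow_natCast,
    ← ENNReal.rpow_mul]
  simp only [ENNReal.toReal_ofNat, ENNReal.rpow_ofNat, Nat.cast_ofNat]
  norm_num
  refine lintegral_congr fun t => ?_
  rw [Real.enorm_eq_ofReal_abs, ← ENNReal.ofReal_pow (abs_nonneg _), sq_abs]

namespace PVM

/-- The approximant is never farther from t than the base point 0 is. This supplies the dominating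
functions for the passages to the limit. -/
theorem norm_approxSeq_le (n : ℕ) (t : ℝ) : ‖approxSeq n t‖ ≤ 2 * ‖t‖ := by
  rw [two_mul]
  exact SimpleFunc.norm_approxOn_zero_le measurable_id (Set.mem_univ 0) t n

theorem tendsto_approxSeq_apply (t : ℝ) : Tendsto (fun n => approxSeq n t) atTop (𝓝 t) :=
  SimpleFunc.tendsto_approxOn measurable_id (Set.mem_univ 0) (by simp)

end PVM

/-! ### The weak integral as a strong limit of simple integrals -/

namespace POVM

variable {Ω : Type*} [MeasurableSpace Ω] {H : Type*} [NormedAddCommGroup H]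
  [InnerProductSpace ℂ H]

theorem mem_sqDomain_iff (Q : POVM ℝ H) (ψ : H) :
    ψ ∈ Q.sqDomain ↔ eLpNorm (fun t : ℝ => t) 2 (Q.diagMeasure ψ) < ∞ := by
  change ∫⁻ t, ENNReal.ofReal (t ^ 2) ∂(Q.diagMeasure ψ) < ∞ ↔ _
  rw [lintegral_ofReal_sq_eq_eLpNorm_sq _ (fun t : ℝ => t)]
  simp

theorem complexMeasure_apply (Q : POVM Ω H) (φ ψ : H) (E : Set Ω) :
    Q.complexMeasure φ ψ E = inner ℂ φ (Q.op E ψ) := rfl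

theorem enorm_complexMeasure_le (Q : POVM Ω H) (φ ψ : H) (E : Set Ω) (hE : MeasurableSet E) :
    ‖Q.complexMeasure φ ψ E‖ₑ ≤
      Q.diagMeasure φ E ^ (1 / 2 : ℝ) * Q.diagMeasure ψ E ^ (1 / 2 : ℝ) := by
  have hφ : 0 ≤ (inner ℂ φ (Q.op E φ)).re := (Q.isPositive E hE).re_inner_nonneg_right φ
  rw [← ENNReal.mul_rpow_of_nonneg _ _ (by norm_num), Q.diagMeasure_apply _ hE,
    Q.diagMeasure_apply _ hE, ← ENNReal.ofReal_mul hφ, one_div,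
    ENNReal.le_rpow_inv_iff zero_lt_two, complexMeasure_apply, ← ofReal_norm, ENNReal.rpow_ofNat,
    ← ENNReal.ofReal_pow (norm_nonneg _)]
  exact ENNReal.ofReal_le_ofReal ((Q.isPositive E hE).norm_inner_sq_le φ ψ)

/-- The Cauchy–Schwarz inequality for the variation of `Q_{φ,ψ}`. -/
theorem lintegral_enorm_variation_le (Q : POVM Ω H) (hQ : Q.IsNormalized) (φ ψ : H) (f : Ω → ℝ) :
    ∫⁻ t, ‖f t‖ₑ ∂(Q.complexMeasure φ ψ).variation ≤ ‖φ‖ₑ * eLpNorm f 2 (Q.diagMeasure ψ) := by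
  refine (VectorMeasure.lintegral_variation_le (Q.enorm_complexMeasure_le φ ψ) _).trans_eq ?_
  rw [eLpNorm_eq_lintegral_rpow_enorm_toReal (by simp) (by simp), ENNReal.toReal_ofNat]
  congr 1
  rw [Q.diagMeasure_apply _ MeasurableSet.univ, show Q.op Set.univ = 1 from hQ]
  have : (inner ℂ φ ((1 : H →L[ℂ] H) φ)).re = ‖φ‖ ^ 2 := by
    rw [← inner_self_eq_norm_sq (𝕜 := ℂ)]
    rfl
  rw [this, ENNReal.ofReal_pow (norm_nonneg _), ofReal_norm, ← ENNReal.rpow_natCast,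
    ← ENNReal.rpow_mul]
  simp

theorem isFiniteMeasure_variation (Q : POVM Ω H) (hQ : Q.IsNormalized) (φ ψ : H) :
    IsFiniteMeasure (Q.complexMeasure φ ψ).variation := by
  refine ⟨?_⟩
  -- With f = 1 the left side is the total variation.
  have h := Q.lintegral_enorm_variation_le hQ φ ψ (fun _ => 1)
  simp only [enorm_one, lintegral_const, one_mul] at h
  exact h.trans_lt (ENNReal.mul_lt_top enorm_lt_top (memLp_const 1).eLpNorm_lt_top)

theorem integrable_complexMeasure (Q : POVM ℝ H) (hQ : Q.IsNormalized) (φ : H) {ψ : H}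
    (hψ : ψ ∈ Q.sqDomain) : (Q.complexMeasure φ ψ).Integrable (fun t : ℝ => t) := by
  refine ⟨measurable_id.aestronglyMeasurable, ?_⟩
  exact (Q.lintegral_enorm_variation_le hQ φ ψ _).trans_lt
    (ENNReal.mul_lt_top enorm_lt_top ((Q.mem_sqDomain_iff ψ).1 hψ))

/-- The integral `∫ s dQ = ∑ c • Q(s = c)` of a real simple function. -/
noncomputable def simpleIntegral (Q : POVM Ω H) (s : SimpleFunc Ω ℝ) : H →L[ℂ] H :=
  ∑ c ∈ s.range, (c : ℂ) • Q.op (s ⁻¹' {c})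

theorem inner_simpleIntegral (Q : POVM Ω H) (hQ : Q.IsNormalized) (s : SimpleFunc Ω ℝ)
    (φ ψ : H) :
    inner ℂ φ (Q.simpleIntegral s ψ) =
      VectorMeasure.integral (Q.complexMeasure φ ψ) s (ContinuousLinearMap.lsmul ℝ ℝ) := by
  have := Q.isFiniteMeasure_variation hQ φ ψ
  rw [VectorMeasure.integral_simpleFunc]
  simp only [simpleIntegral, sum_apply, smul_apply, inner_sum, inner_smul_right]
  rfl

/-- The coefficients are real and each Q(E) is symmetric; hermiticity of the weak integral is the
limit of this identity. -/
theorem inner_simpleIntegral_left (Q : POVM Ω H) (s : SimpleFunc Ω ℝ) (x y : H) :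
    inner ℂ (Q.simpleIntegral s x) y = inner ℂ x (Q.simpleIntegral s y) := by
  simp only [simpleIntegral, sum_apply, smul_apply, inner_sum, inner_smul_right, sum_inner,
    inner_smul_left, Complex.conj_ofReal]
  refine Finset.sum_congr rfl fun c _ => ?_
  rw [(Q.isPositive _ (s.measurableSet_fiber c)).inner_left_eq_inner_right]

/-- For a PVM this would be an equality by orthogonality of the level projections. For a POVM
duality replaces orthogonality: the difference w is tested against itself, and one factor ‖w‖
cancels. -/
theorem edist_simpleIntegral_le (Q : POVM Ω H) (hQ : Q.IsNormalized) (s t : SimpleFunc Ω ℝ)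
    (ψ : H) :
    edist (Q.simpleIntegral s ψ) (Q.simpleIntegral t ψ) ≤
      eLpNorm (⇑s - ⇑t) 2 (Q.diagMeasure ψ) := by
  rw [edist_eq_enorm_sub]
  set w := Q.simpleIntegral s ψ - Q.simpleIntegral t ψ with hw
  have := Q.isFiniteMeasure_variation hQ w ψ
  rcases eq_or_ne w 0 with h0 | h0
  · simp [h0]
  have h1 : ‖w‖ₑ * ‖w‖ₑ = ‖inner ℂ w w‖ₑ := by
    rw [inner_self_eq_norm_sq_to_K, enorm_pow, sq]
    congr 1 <;> simp [enorm]
  have h2 : inner ℂ w w = VectorMeasure.integral (Q.complexMeasure w ψ) (⇑s - ⇑t)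
      (ContinuousLinearMap.lsmul ℝ ℝ) := by
    rw [VectorMeasure.integral_sub s.integrable_of_isFiniteMeasure
      t.integrable_of_isFiniteMeasure, ← Q.inner_simpleIntegral hQ, ← Q.inner_simpleIntegral hQ,
      ← inner_sub_right]
  have h3 : ‖w‖ₑ * ‖w‖ₑ ≤ ‖w‖ₑ * eLpNorm (⇑s - ⇑t) 2 (Q.diagMeasure ψ) := by
    rw [h1, h2]
    refine VectorMeasure.enorm_integral_le_lintegral_enorm_transpose.trans ?_
    rw [VectorMeasure.variation_transpose_lsmul]
    exact Q.lintegral_enorm_variation_le hQ w ψ _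
  exact (ENNReal.mul_le_mul_iff_right (by simpa using h0) enorm_ne_top).1 h3

theorem tendsto_inner_simpleIntegral (Q : POVM ℝ H) (hQ : Q.IsNormalized) (φ : H) {ψ : H}
    (hψ : ψ ∈ Q.sqDomain) :
    Tendsto (fun n => inner ℂ φ (Q.simpleIntegral (PVM.approxSeq n) ψ)) atTop
      (𝓝 (VectorMeasure.integral (Q.complexMeasure φ ψ) (fun t : ℝ => t)
        (ContinuousLinearMap.lsmul ℝ ℝ))) := by
  simp only [Q.inner_simpleIntegral hQ]
  refine VectorMeasure.tendsto_integral_of_dominated_convergence (fun t => 2 * ‖t‖)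
    (fun n => (PVM.approxSeq n).aestronglyMeasurable)
    ((Q.integrable_complexMeasure hQ φ hψ).norm.const_mul 2)
    (fun n => ae_of_all _ (PVM.norm_approxSeq_le n))
    (ae_of_all _ PVM.tendsto_approxSeq_apply)

theorem tendsto_eLpNorm_approxSeq_sub (Q : POVM ℝ H) {ψ : H} (hψ : ψ ∈ Q.sqDomain) :
    Tendsto (fun n => eLpNorm (fun t => PVM.approxSeq n t - t) 2 (Q.diagMeasure ψ)) atTop
      (𝓝 0) := by
  refine SimpleFunc.tendsto_approxOn_Lp_eLpNorm measurable_id (Set.mem_univ 0) (by simp)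
    (by simp) ?_
  simpa using (Q.mem_sqDomain_iff ψ).1 hψ

theorem exists_tendsto_simpleIntegral [CompleteSpace H] (Q : POVM ℝ H) (hQ : Q.IsNormalized)
    {ψ : H} (hψ : ψ ∈ Q.sqDomain) :
    ∃ y, Tendsto (fun n => Q.simpleIntegral (PVM.approxSeq n) ψ) atTop (𝓝 y) := by
  refine cauchySeq_tendsto_of_complete (EMetric.cauchySeq_iff.2 fun ε hε => ?_)
  obtain ⟨N, hN⟩ := eventually_atTop.1
    ((Q.tendsto_eLpNorm_approxSeq_sub hψ).eventually_lt_const (ENNReal.half_pos hε.ne'))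
  refine ⟨N, fun m hm n hn => (Q.edist_simpleIntegral_le hQ _ _ ψ).trans_lt ?_⟩
  have h : ⇑(PVM.approxSeq m) - ⇑(PVM.approxSeq n) =
      (fun t => PVM.approxSeq m t - t) - (fun t => PVM.approxSeq n t - t) := by
    ext t
    simp
  have hmeas : ∀ k, AEStronglyMeasurable (fun t => PVM.approxSeq k t - t) (Q.diagMeasure ψ) :=
    fun k => ((PVM.approxSeq k).measurable.sub measurable_id).aestronglyMeasurable
  rw [h]
  calc _ ≤ _ := eLpNorm_sub_le (hmeas m) (hmeas n) (by norm_num)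
    _ < ε / 2 + ε / 2 := ENNReal.add_lt_add (hN m hm) (hN n hn)
    _ = ε := ENNReal.add_halves ε

theorem IsWeakIntegral.mem_sqDomain {Q : POVM ℝ H} {A : H →ₗ.[ℂ] H} (hA : Q.IsWeakIntegral A)
    (ψ : A.domain) : (ψ : H) ∈ Q.sqDomain :=
  hA.1 ▸ ψ.2

/-- A weak integral is the strong limit of the integrals of simple functions. -/
theorem IsWeakIntegral.tendsto_simpleIntegral [CompleteSpace H] {Q : POVM ℝ H}
    (hQ : Q.IsNormalized) {A : H →ₗ.[ℂ] H} (hA : Q.IsWeakIntegral A) (ψ : A.domain) :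
    Tendsto (fun n => Q.simpleIntegral (PVM.approxSeq n) (ψ : H)) atTop (𝓝 (A ψ)) := by
  obtain ⟨y, hy⟩ := Q.exists_tendsto_simpleIntegral hQ (hA.mem_sqDomain ψ)
  have : y = A ψ := by
    refine ext_inner_left ℂ fun φ => ?_
    rw [hA.2 φ ψ]
    exact tendsto_nhds_unique (tendsto_const_nhds.inner hy)
      (Q.tendsto_inner_simpleIntegral hQ φ (hA.mem_sqDomain ψ))
  exact this ▸ hy

theorem exists_isWeakIntegral [CompleteSpace H] (Q : POVM ℝ H) (hQ : Q.IsNormalized) :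
    ∃ A : H →ₗ.[ℂ] H, Q.IsWeakIntegral A := by
  choose y hy using fun ψ : Q.sqSubmodule => Q.exists_tendsto_simpleIntegral hQ ψ.2
  let A : H →ₗ.[ℂ] H :=
    { domain := Q.sqSubmodule
      toFun :=
        { toFun := y
          map_add' := fun x z => tendsto_nhds_unique (hy (x + z)) <| by
            simpa using (hy x).add (hy z)
          map_smul' := fun c x => tendsto_nhds_unique (hy (c • x)) <| by
            simpa using (hy x).const_smul c } }
  exact ⟨A, rfl, fun φ ψ => tendsto_nhds_unique (tendsto_const_nhds.inner (hy ψ))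
    (Q.tendsto_inner_simpleIntegral hQ φ ψ.2)⟩

theorem IsWeakIntegral.unique {Q : POVM ℝ H} {A B : H →ₗ.[ℂ] H} (hA : Q.IsWeakIntegral A)
    (hB : Q.IsWeakIntegral B) : A = B := by
  refine LinearPMap.ext (SetLike.coe_injective (hA.1.trans hB.1.symm)) fun x hx hx' => ?_
  refine ext_inner_left ℂ fun φ => ?_
  rw [hA.2 φ ⟨x, hx⟩, hB.2 φ ⟨x, hx'⟩]

theorem IsWeakIntegral.isHermitianOp [CompleteSpace H] {Q : POVM ℝ H} (hQ : Q.IsNormalized)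
    {A : H →ₗ.[ℂ] H} (hA : Q.IsWeakIntegral A) : A.IsHermitianOp := fun x y => by
  refine tendsto_nhds_unique ((hA.tendsto_simpleIntegral hQ x).inner tendsto_const_nhds) ?_
  simp only [Q.inner_simpleIntegral_left]
  exact tendsto_const_nhds.inner (hA.tendsto_simpleIntegral hQ y)

end POVM

/-! ### Compression of the spectral integral of a Naimark dilation -/

namespace PVM

theorem enorm_integralVec_sq {K : Type*} [NormedAddCommGroup K] [InnerProductSpace ℂ K]
    [CompleteSpace K] (P : PVM ℝ K) {x : K} (hx : x ∈ P.toPOVM.sqDomain) :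
    ‖P.integralVec x‖ₑ ^ 2 = ∫⁻ t, ENNReal.ofReal (t ^ 2) ∂(P.diagMeasure x) := by
  refine tendsto_nhds_unique ((ENNReal.continuous_pow 2).tendsto _ |>.comp
    (P.tendsto_integralVec_seq hx).enorm) ?_
  have h : ∀ n, ‖P.simpleIntegral (approxSeq n) x‖ₑ ^ 2 =
      ∫⁻ t, ENNReal.ofReal (approxSeq n t ^ 2) ∂(P.diagMeasure x) := fun n => by
    rw [P.enorm_simpleIntegral, lintegral_ofReal_sq_eq_eLpNorm_sq]
  simp only [Function.comp_def, h]
  -- The isometry for simple functions passes to the limit; the factor 4 is the square of the 2 in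
  -- `norm_approxSeq_le`.
  refine tendsto_lintegral_of_dominated_convergence (fun t => 4 * ENNReal.ofReal (t ^ 2))
    (fun n => ENNReal.measurable_ofReal.comp ((approxSeq n).measurable.pow_const 2))
    (fun n => ae_of_all _ fun t => ?_) ?_ (ae_of_all _ fun t => ?_)
  · dsimp only
    rw [show (4 : ℝ≥0∞) = ENNReal.ofReal 4 by simp, ← ENNReal.ofReal_mul (by norm_num)]
    refine ENNReal.ofReal_le_ofReal ?_
    have h1 := pow_le_pow_left₀ (norm_nonneg _) (norm_approxSeq_le n t) 2
    rw [mul_pow, Real.norm_eq_abs, Real.norm_eq_abs, sq_abs, sq_abs] at h1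
    linarith
  · rw [lintegral_const_mul _ (by fun_prop)]
    exact (ENNReal.mul_lt_top (by simp) hx).ne
  · exact ENNReal.tendsto_ofReal ((tendsto_approxSeq_apply t).pow 2)

end PVM

namespace NaimarkDilation

variable {Ω : Type*} [MeasurableSpace Ω] {H : Type*} [NormedAddCommGroup H]
  [InnerProductSpace ℂ H] [CompleteSpace H] {K : Type*} [NormedAddCommGroup K]
  [InnerProductSpace ℂ K] [CompleteSpace K]

/-- The adjoint of V moves across the inner product. Hence D is exactly the part of the domain of ∫
λ dP that lies in H. -/
theorem diagMeasure_V {Q : POVM Ω H} (N : NaimarkDilation Q K) (ψ : H) :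
    N.P.diagMeasure (N.V ψ) = Q.diagMeasure ψ := by
  ext E hE
  rw [POVM.diagMeasure_apply _ _ hE, POVM.diagMeasure_apply _ _ hE, N.op_eq E hE]
  simp only [ContinuousLinearMap.comp_apply, ContinuousLinearMap.adjoint_inner_right]
  rfl

theorem simpleIntegral_eq {Q : POVM Ω H} (N : NaimarkDilation Q K) (s : SimpleFunc Ω ℝ) (ψ : H) :
    Q.simpleIntegral s ψ = ContinuousLinearMap.adjoint N.V.toContinuousLinearMap
      (N.P.simpleIntegral s (N.V ψ)) := by
  simp only [POVM.simpleIntegral, PVM.simpleIntegral, sum_apply, smul_apply, map_sum, map_smul]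
  refine Finset.sum_congr rfl fun c _ => ?_
  rw [N.op_eq _ (s.measurableSet_fiber c)]
  rfl

theorem V_mem_sqDomain_iff {Q : POVM ℝ H} (N : NaimarkDilation Q K) (ψ : H) :
    N.V ψ ∈ N.P.toPOVM.sqDomain ↔ ψ ∈ Q.sqDomain := by
  simp only [POVM.sqDomain, Set.mem_ofPred_eq, N.diagMeasure_V]

theorem weakIntegral_eq {Q : POVM ℝ H} (hQ : Q.IsNormalized) {A : H →ₗ.[ℂ] H}
    (hA : Q.IsWeakIntegral A) (N : NaimarkDilation Q K) (ψ : A.domain) :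
    A ψ = ContinuousLinearMap.adjoint N.V.toContinuousLinearMap (N.P.integralVec (N.V ψ)) := by
  refine tendsto_nhds_unique (hA.tendsto_simpleIntegral hQ ψ) ?_
  simp only [N.simpleIntegral_eq]
  exact ((ContinuousLinearMap.continuous _).tendsto _).comp
    (N.P.tendsto_integralVec_seq ((N.V_mem_sqDomain_iff ψ).2 (hA.mem_sqDomain ψ)))

/-- If `∫ λ dP(λ)` maps `ψ` into `H`, the compression is isometric at `ψ`. -/
theorem enorm_weakIntegral_sq {Q : POVM ℝ H} (hQ : Q.IsNormalized) {A : H →ₗ.[ℂ] H}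
    (hA : Q.IsWeakIntegral A) (N : NaimarkDilation Q K) (ψ : A.domain)
    (hψ : N.P.integralVec (N.V ψ) ∈ Set.range N.V) :
    ‖A ψ‖ₑ ^ 2 = ∫⁻ t, ENNReal.ofReal (t ^ 2) ∂(Q.diagMeasure (ψ : H)) := by
  obtain ⟨y, hy⟩ := hψ
  -- V†V = I, so compressing a vector that already lies in H returns it.
  have hAy : A ψ = y := by
    rw [N.weakIntegral_eq hQ hA ψ, ← hy]
    refine ext_inner_left ℂ fun φ => ?_
    rw [ContinuousLinearMap.adjoint_inner_right]
    exact N.V.inner_map_map φ y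
  have hn : ‖y‖ₑ = ‖N.V y‖ₑ := by rw [← ofReal_norm, ← ofReal_norm, N.V.norm_map]
  rw [hAy, hn, hy, N.P.enorm_integralVec_sq ((N.V_mem_sqDomain_iff _).2 (hA.mem_sqDomain ψ)),
    N.diagMeasure_V]

end NaimarkDilation

/-! ### Lower semicontinuity of the second moment and closedness -/

namespace POVM

variable {Ω : Type*} [MeasurableSpace Ω] {H : Type*} [NormedAddCommGroup H]
  [InnerProductSpace ℂ H]

/-- A supremum of continuous functions: for a simple g ≤ f the integral is a finite combination of
the forms ⟨ψ|Q(E)ψ⟩. Taking g with finite values keeps multiplication by its values continuous. -/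
theorem lowerSemicontinuous_lintegral_diagMeasure (Q : POVM Ω H) (f : Ω → ℝ≥0∞) :
    LowerSemicontinuous fun ψ => ∫⁻ t, f t ∂(Q.diagMeasure ψ) := by
  simp only [lintegral_eq_nnreal]
  refine lowerSemicontinuous_biSup fun g _ => Continuous.lowerSemicontinuous ?_
  simp only [SimpleFunc.map_lintegral]
  refine continuous_finsetSum _ fun c _ => ?_
  simp only [Q.diagMeasure_apply _ (g.measurableSet_fiber c)]
  refine (ENNReal.continuous_const_mul ENNReal.coe_ne_top).comp
    (ENNReal.continuous_ofReal.comp (Complex.continuous_re.comp ?_))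
  exact continuous_id.inner (Q.op _).continuous

/-- A weak integral that satisfies `‖A ψ‖² = ∫ λ² dQ_{ψ,ψ}(λ)` is closed. -/
theorem IsWeakIntegral.isClosed {Q : POVM ℝ H} {A : H →ₗ.[ℂ] H} (hA : Q.IsWeakIntegral A)
    (hn : ∀ ψ : A.domain,
      ‖A ψ‖ₑ ^ 2 = ∫⁻ t, ENNReal.ofReal (t ^ 2) ∂(Q.diagMeasure (ψ : H))) :
    A.IsClosed := by
  refine IsSeqClosed.isClosed fun u p hu hup => ?_
  rw [SetLike.mem_coe, LinearPMap.mem_graph_iff]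
  have hu' : ∀ n, ∃ ψ : A.domain, (ψ : H) = (u n).1 ∧ A ψ = (u n).2 := fun n =>
    (LinearPMap.mem_graph_iff A).1 (hu n)
  choose ψ hψ1 hψ2 using hu'
  have h1 : Tendsto (fun n => (ψ n : H)) atTop (𝓝 p.1) := by
    simpa only [hψ1] using hup.fst_nhds
  have h2 : Tendsto (fun n => A (ψ n)) atTop (𝓝 p.2) := by
    simpa only [hψ2] using hup.snd_nhds
  -- By `hn` the second moment at ψ n - ψ m is ‖A (ψ n) - A (ψ m)‖²; lower semicontinuity bounds the
  -- limit n → ∞ for fixed m.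
  have hle : ∀ m, ∫⁻ t, ENNReal.ofReal (t ^ 2) ∂(Q.diagMeasure (p.1 - ψ m)) ≤
      ‖p.2 - A (ψ m)‖ₑ ^ 2 := fun m => by
    have hlim : Tendsto (fun n => ‖A (ψ n) - A (ψ m)‖ₑ ^ 2) atTop (𝓝 (‖p.2 - A (ψ m)‖ₑ ^ 2)) :=
      ((ENNReal.continuous_pow 2).tendsto _).comp (h2.sub_const _).enorm
    refine le_of_forall_lt_imp_le_of_dense fun b hb => ?_
    refine ge_of_tendsto hlim (((h1.sub_const (ψ m : H)).eventually
      (Q.lowerSemicontinuous_lintegral_diagMeasure _ _ b hb)).mono fun n hbn => ?_)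
    rw [← LinearPMap.map_sub, hn]
    exact hbn.le
  have hsub : ∀ m, p.1 - ψ m ∈ A.domain := fun m => by
    rw [← SetLike.mem_coe, hA.1]
    exact (hle m).trans_lt (by simp)
  have hp : p.1 ∈ A.domain := by
    simpa using A.domain.add_mem (hsub 0) (ψ 0).2
  refine ⟨⟨p.1, hp⟩, rfl, ?_⟩
  -- Now that p.1 lies in the domain, `hn` also rewrites the left side of `hle`. Thus A (ψ m) tends
  -- to the value of A at p.1 as well as to p.2.
  have hdiff : ∀ m, ‖A ⟨p.1, hp⟩ - A (ψ m)‖ ≤ ‖p.2 - A (ψ m)‖ := fun m => by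
    have h := hle m
    rw [show p.1 - ψ m = ((⟨p.1, hp⟩ - ψ m : A.domain) : H) from rfl, ← hn, LinearPMap.map_sub,
      ← ofReal_norm, ← ofReal_norm, ← ENNReal.ofReal_pow (norm_nonneg _),
      ← ENNReal.ofReal_pow (norm_nonneg _), ENNReal.ofReal_le_ofReal_iff (by positivity)] at h
    exact le_of_sq_le_sq h (norm_nonneg _)
  refine tendsto_nhds_unique (f := fun m => A (ψ m)) (l := atTop) ?_ h2
  rw [tendsto_iff_norm_sub_tendsto_zero] at h2 ⊢
  refine squeeze_zero (fun _ => norm_nonneg _) (fun m => ?_) h2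
  rw [norm_sub_rev, norm_sub_rev (A (ψ m))]
  exact hdiff m

/-! ### POVMs with trivial domain -/

/-- The POVM `E ↦ μ(E) I` of a finite measure `μ`. -/
noncomputable def ofMeasure (H : Type*) [NormedAddCommGroup H] [InnerProductSpace ℂ H]
    (μ : Measure Ω) [IsFiniteMeasure μ] : POVM Ω H where
  -- Unlike μ, its signed measure vanishes on non-measurable sets, as a `POVM` must.
  op E := ((μ.toSignedMeasure E : ℝ) : ℂ) • 1
  op_of_not_measurable E hE := by simp [VectorMeasure.not_measurable _ hE]
  isPositive E hE := by
    refine ContinuousLinearMap.IsPositive.smul_of_nonneg ContinuousLinearMap.isPositive_one ?_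
    rw [Measure.toSignedMeasure_apply_measurable hE]
    exact_mod_cast measureReal_nonneg
  hasSum_inner φ ψ E hE hd := by
    simp only [smul_apply, one_apply_eq_self, inner_smul_right]
    exact (Complex.hasSum_ofReal.2 (μ.toSignedMeasure.m_iUnion hE hd)).mul_right _

theorem isNormalized_ofMeasure (μ : Measure Ω) [IsProbabilityMeasure μ] :
    (ofMeasure H μ).IsNormalized := by
  simp [IsNormalized, ofMeasure]

theorem diagMeasure_ofMeasure (μ : Measure Ω) [IsFiniteMeasure μ] (ψ : H) :
    (ofMeasure H μ).diagMeasure ψ = ENNReal.ofReal (‖ψ‖ ^ 2) • μ := by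
  ext E hE
  rw [diagMeasure_apply _ _ hE, Measure.smul_apply, smul_eq_mul]
  have : inner ℂ ψ ((ofMeasure H μ).op E ψ) = ((μ.real E * ‖ψ‖ ^ 2 : ℝ) : ℂ) := by
    simp [ofMeasure, hE, inner_self_eq_norm_sq_to_K]
  rw [this, Complex.ofReal_re, mul_comm, ENNReal.ofReal_mul (by positivity), ofReal_measureReal]

/-- Here Q_{ψ,ψ} = ‖ψ‖² μ, so a single nonzero ψ in the domain would make the second moment of μ
finite. -/
theorem sqDomain_ofMeasure {μ : Measure ℝ} [IsFiniteMeasure μ]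
    (hμ : ∫⁻ t, ENNReal.ofReal (t ^ 2) ∂μ = ∞) : (ofMeasure H μ).sqDomain = {0} := by
  ext ψ
  simp only [sqDomain, Set.mem_ofPred_eq, diagMeasure_ofMeasure, lintegral_smul_measure, hμ,
    smul_eq_mul, Set.mem_singleton_iff]
  by_cases h : ψ = 0
  · simp [h]
  · simp [h]

end POVM

/-- There is a probability measure on the real line without second moment. -/
theorem exists_isProbabilityMeasure_lintegral_sq_eq_top :
    ∃ μ : Measure ℝ, IsProbabilityMeasure μ ∧ ∫⁻ t, ENNReal.ofReal (t ^ 2) ∂μ = ∞ := by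
  -- The exponent n + 1 makes the total mass 1. The atom at 2ⁿ contributes 4ⁿ/2ⁿ⁺¹ ≥ 1/2 to the
  -- second moment.
  refine ⟨Measure.sum fun n : ℕ => (2⁻¹ : ℝ≥0∞) ^ (n + 1) • Measure.dirac ((2 : ℝ) ^ n),
    ⟨?_⟩, ?_⟩
  · simp [ENNReal.tsum_geometric_add_one, ENNReal.inv_mul_cancel]
  · rw [lintegral_sum_measure]
    refine top_unique ?_
    have h : ∑' _ : ℕ, (2⁻¹ : ℝ≥0∞) = ∞ := ENNReal.tsum_const_eq_top_of_ne_zero (by simp)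
    rw [← h]
    refine ENNReal.tsum_le_tsum fun n => ?_
    rw [lintegral_smul_measure, lintegral_dirac, smul_eq_mul, pow_succ, mul_comm _ 2⁻¹, mul_assoc]
    refine le_mul_of_one_le_right' ?_
    rw [← pow_mul, ENNReal.ofReal_pow zero_le_two, ENNReal.ofReal_ofNat, pow_mul, sq, ← mul_assoc,
      ← mul_pow, ENNReal.inv_mul_cancel two_ne_zero ENNReal.ofNat_ne_top, one_pow, one_mul]
    exact one_le_pow₀ one_le_two

/-! ### The main theorem -/

theorem theorem3p8 {H : Type*} [NormedAddCommGroup H] [InnerProductSpace ℂ H] [CompleteSpace H]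
    (Q : POVM ℝ H) (hQ : Q.IsNormalized) :
    -- (a) the domain is a subspace, in general neither dense nor different from `{0}`
    (∃ S : Submodule ℂ H, (S : Set H) = Q.sqDomain) ∧
    (Nontrivial H →
      (∃ Q' : POVM ℝ H, Q'.IsNormalized ∧ ¬ Dense Q'.sqDomain) ∧
      (∃ Q' : POVM ℝ H, Q'.IsNormalized ∧ Q'.sqDomain = {0})) ∧
    -- (b) the integrals converge absolutely and define a unique operator
    (∀ φ : H, ∀ ψ ∈ Q.sqDomain, (Q.complexMeasure φ ψ).Integrable (fun t : ℝ => t)) ∧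
    (∃! A : H →ₗ.[ℂ] H, Q.IsWeakIntegral A) ∧
    ∀ A : H →ₗ.[ℂ] H, Q.IsWeakIntegral A →
      -- (c) it is Hermitian, and symmetric exactly if the domain is dense
      A.IsHermitianOp ∧
      (A.IsSymmetricOp ↔ Dense Q.sqDomain) ∧
      ∀ (K : Type*) [NormedAddCommGroup K] [InnerProductSpace ℂ K] [CompleteSpace K]
        (N : NaimarkDilation Q K),
        -- (d) it is the compression of `∫ λ dP(λ)`
        (∀ ψ : A.domain, ∃ h : N.V ψ ∈ N.P.integral.domain,
          N.V (A ψ) = N.projH (N.P.integral ⟨N.V ψ, h⟩)) ∧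
        -- (e) the case that `∫ λ dP(λ)` maps the domain into `H`
        ((∀ x : N.P.integral.domain, (x : K) ∈ N.V '' Q.sqDomain →
            N.P.integral x ∈ Set.range N.V) →
          A.IsClosed ∧
          ∀ ψ : A.domain, ‖A ψ‖ ^ 2 = ∫ t, t ^ 2 ∂(Q.diagMeasure (ψ : H))) := by
  refine ⟨⟨Q.sqSubmodule, rfl⟩, fun hH => ?_,
    fun φ ψ hψ => Q.integrable_complexMeasure hQ φ hψ, ?_, fun A hA =>
      ⟨hA.isHermitianOp hQ, ?_, fun K _ _ _ N => ⟨fun ψ => ?_, fun hN => ?_⟩⟩⟩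
  -- One POVM serves both claims: {0} is closed, hence not dense in a nontrivial space.
  · obtain ⟨μ, _, hμ⟩ := exists_isProbabilityMeasure_lintegral_sq_eq_top
    have h0 := POVM.sqDomain_ofMeasure (H := H) hμ
    refine ⟨⟨_, POVM.isNormalized_ofMeasure μ, ?_⟩, ⟨_, POVM.isNormalized_ofMeasure μ, h0⟩⟩
    rw [h0, dense_iff_closure_eq, closure_singleton]
    exact fun h => not_subsingleton H (Set.subsingleton_univ_iff.1 (h ▸ Set.subsingleton_singleton))
  · obtain ⟨A, hA⟩ := Q.exists_isWeakIntegral hQ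
    exact ⟨A, hA, fun B hB => hB.unique hA⟩
  · rw [← hA.1]
    exact ⟨fun h => h.2, fun h => ⟨hA.isHermitianOp hQ, h⟩⟩
  · exact ⟨(N.V_mem_sqDomain_iff _).2 (hA.mem_sqDomain ψ),
      congrArg N.V (N.weakIntegral_eq hQ hA ψ)⟩
  · have hn : ∀ ψ : A.domain,
        ‖A ψ‖ₑ ^ 2 = ∫⁻ t, ENNReal.ofReal (t ^ 2) ∂(Q.diagMeasure (ψ : H)) := fun ψ =>
      N.enorm_weakIntegral_sq hQ hA ψ <|
        hN ⟨N.V ψ, (N.V_mem_sqDomain_iff _).2 (hA.mem_sqDomain ψ)⟩ ⟨ψ, hA.mem_sqDomain ψ, rfl⟩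
    refine ⟨hA.isClosed hn, fun ψ => ?_⟩
    rw [integral_eq_lintegral_of_nonneg_ae (ae_of_all _ fun t => sq_nonneg t) (by fun_prop),
      ← hn ψ, ENNReal.toReal_pow, toReal_enorm]
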